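/- Let $F$ be an algebraically closed field of characteristic zero, and let $e_{ij}$ ($1\le i,j\le 3$) be the matrix units of $M_3(F)$. A linear operator $R$ on an $F$-algebra $A$ is a Rota–Baxter operator (RB-operator) of weight $1$ if $R(x)R(y)=R(R(x)y+xR(y)+xy)$ for all $x,y\in A$. Put $\phi(R)=R'=-R-\mathrm{id}$, and let $T$ denote transpose. The orbit of an operator $R$ on $M_3(F)$ is its orbit under the group generated by $\phi$, by the conjugations $R\mapsto\psi^{-1}R\psi$ with $\psi\in\mathrm{Aut}(M_3(F))$, and by the conjugation $R\mapsto T\circ R\circ T$. Consider the following 36 linear operators on $M_3(F)$. A) (20 primitive operators) For a linear operator $P$ on the diagonal subalgebra $D_3=Ff_1\oplus Ff_2\oplus Ff_3$, $f_i=e_{ii}$, extend $P$ to $M_3(F)$ by $R|_{D_3}=P$, $R(e_{ij})=0$ for $i<j$, and $R(e_{ij})=-e_{ij}$ for $i>j$. Let $Xa$ be the extension of the following $P$, for $X=1,\dots,7$: 1) $f_1\mapsto f_2+f_3$, $f_2\mapsto f_3$, $f_3\mapsto 0$; 2) $f_1\mapsto f_2+f_3$, $f_2\mapsto f_3$, $f_3\mapsto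 -f_3$; 3) $f_1\mapsto f_2+f_3$, $f_2\mapsto -(f_2+f_3)$, $f_3\mapsto -f_3$; 4) $f_1\mapsto f_2+f_3$, $f_2\mapsto -f_2$, $f_3\mapsto 0$; 5) $f_1\mapsto f_2+f_3$, $f_2\mapsto 0$, $f_3\mapsto 0$; 6) $f_1\mapsto f_2$, $f_2\mapsto 0$, $f_3\mapsto 0$; 7) $f_1\mapsto f_2$, $f_2\mapsto 0$, $f_3\mapsto -f_3$. Let $Xb$ (respectively $Xc$) be the extension of the operator obtained from case $X$ by conjugation with the automorphism of $D_3$ that swaps $f_1,f_2$ (respectively $f_2,f_3$). The list contains all $Xa$, $Xb$, $Xc$, $X=1,\dots,7$, except $5c$. B) The four operators 1-I) $R(e_{11})=e_{22}+e_{33}$, $R(e_{22})=e_{33}$; $e_{31},e_{32},e_{33}\in\ker R$; $e_{12},e_{13}\in\ker R'$; $R(e_{21})=-e_{32}$, $R(e_{23})=e_{12}-e_{23}$; 6-I) $e_{22},e_{23},e_{32},e_{33}\in\ker R$; $R(e_{11})=e_{22}$, $R(e_{12})=-e_{12}-e_{32}$, $R(e_{21})=-e_{21}+e_{23}$, $R(e_{13})=e_{11}+e_{22}-e_{13}$,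 $R(e_{31})=-e_{31}+e_{33}$; 6-II) $e_{12},e_{13},e_{22},e_{23},e_{32},e_{33}\in\ker R$; $R(e_{11})=e_{22}$, $R(e_{21})=-e_{21}$, $R(e_{31})=-e_{31}+e_{11}+e_{22}$; 6-III) $e_{12},e_{13},e_{22},e_{23},e_{32},e_{33}\in\ker R$; $R(e_{11})=e_{22}$, $R(e_{21})=-e_{21}-e_{23}$, $R(e_{31})=-e_{31}+e_{11}+e_{22}$. C) The twelve operators with $e_{12},e_{13}\in\ker R'$, $e_{21},e_{31}\in\ker R$ and 2-I) $R(e_{11})=e_{22}+e_{33}$, $R(e_{22})=e_{33}$; $e_{23},e_{33}\in\ker R'$; $R(e_{32})=e_{33}$; 2-II) $R(e_{11})=e_{22}+e_{33}$, $R(e_{22})=e_{33}$; $e_{32},e_{33}\in\ker R'$; $R(e_{23})=e_{33}$; 3-I) $e_{11},e_{23}\in\ker R'$; $-R(e_{22})=R(e_{33})=R(e_{32})=e_{11}+e_{22}$; 3-II) $e_{11},e_{32}\in\ker R'$; $-R(e_{22})=R(e_{33})=R(e_{23})=e_{11}+e_{22}$; 4-I) $R(e_{22})=e_{11}+e_{33}$;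 $e_{33},e_{32}\in\ker R'$; $e_{11}\in\ker R$; $R(e_{23})=e_{33}$; 4-II) $R(e_{22})=e_{11}+e_{33}$; $e_{33},e_{23}\in\ker R'$; $e_{11}\in\ker R$; $R(e_{32})=e_{33}$; 5-I) $R(e_{11})=e_{22}+e_{33}$; $e_{22},e_{23},e_{32},e_{33}\in\ker R$; 5-II) $R(e_{11})=e_{22}+e_{33}$; $e_{22},e_{23},e_{33}\in\ker R$; $R(e_{32})=e_{33}-e_{32}$; 6-IV) $e_{11},e_{33},e_{32}\in\ker R$; $R(e_{22})=e_{11}$, $R(e_{23})=-e_{23}+e_{11}+e_{22}$; 6-V) $e_{11},e_{33},e_{23}\in\ker R$; $R(e_{22})=e_{11}$, $R(e_{32})=-e_{32}+e_{11}+e_{22}$; 6-VI) $e_{22},e_{33},e_{23},e_{32}\in\ker R$; $R(e_{11})=e_{22}$; 8-I) $e_{11}\in\ker R'$; $e_{22},e_{23},e_{33}\in\ker R$; $R(e_{32})=e_{11}+e_{22}-e_{32}$. Then all 36 operators are RB-operators of weight $1$ on $M_3(F)$, and they lie in pairwise distinct orbits. -/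

import Mathlib

namespace RotaBaxter

/-- `R` is a Rota-Baxter operator of weight `lam` on the `F`-algebra `A`. -/
def IsRotaBaxter {F A : Type*} [Field F] [Ring A] [Algebra F A] (lam : F)
    (R : Module.End F A) : Prop :=
  ∀ x y : A, R x * R y = R (R x * y + x * R y + lam • (x * y))

section Symmetries

variable {F A : Type*} [Field F] [Ring A] [Algebra F A]

/-- The map `φ` for weight `lam`: `φ(P) = -P - lam • id`. -/
def phi (lam : F) (P : Module.End F A) : Module.End F A :=
  -P - lam • LinearMap.id

theorem phi_involutive (lam : F) :
    Function.Involutive (phi (A := A) lam) := by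
  intro P
  simp [phi]

/-- `φ` as a permutation of the set of linear operators. -/
def phiPerm (lam : F) : Equiv.Perm (Module.End F A) :=
  (phi_involutive lam).toPerm

/-- Conjugation with an automorphism `ψ`: `P ↦ ψ⁻¹ P ψ`. -/
def conjPerm (ψ : A ≃ₐ[F] A) : Equiv.Perm (Module.End F A) where
  toFun P := ψ.symm.toLinearMap ∘ₗ P ∘ₗ ψ.toLinearMap
  invFun P := ψ.toLinearMap ∘ₗ P ∘ₗ ψ.symm.toLinearMap
  left_inv P := by ext x; simp
  right_inv P := by ext x; simp

end Symmetries

/-- The algebra `M₃(F)`. -/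
abbrev M3 (F : Type*) : Type _ := Matrix (Fin 3) (Fin 3) F

variable {F : Type*} [Field F]

/-- Conjugation with transpose: `P ↦ T ∘ P ∘ T`, where `T x = xᵀ`. -/
def transposePerm : Equiv.Perm (Module.End F (M3 F)) :=
  Function.Involutive.toPerm
    (fun P => (Matrix.transposeLinearEquiv (Fin 3) (Fin 3) F F).toLinearMap ∘ₗ P ∘ₗ
      (Matrix.transposeLinearEquiv (Fin 3) (Fin 3) F F).toLinearMap)
    (by intro P; ext x; simp)

variable (F) in
/-- The group generated by `φ` (for weight 1), by the conjugations with all automorphisms of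
the `F`-algebra `M₃(F)`, and by the conjugation with transpose. -/
def symmetryGroup : Subgroup (Equiv.Perm (Module.End F (M3 F))) :=
  Subgroup.closure ({phiPerm 1, transposePerm} ∪ Set.range conjPerm)

/-- The orbit of an operator under the group generated by `φ`, conjugations with automorphisms,
and conjugation with transpose. -/
def orbit (R : Module.End F (M3 F)) : Set (Module.End F (M3 F)) :=
  MulAction.orbit (symmetryGroup F) R

/-! The matrix units of `M₃(F)`. -/

/-- Matrix unit. -/
def e11 : M3 F := Matrix.single 0 0 1
/-- Matrix unit. -/
def e12 : M3 F := Matrix.single 0 1 1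
/-- Matrix unit. -/
def e13 : M3 F := Matrix.single 0 2 1
/-- Matrix unit. -/
def e21 : M3 F := Matrix.single 1 0 1
/-- Matrix unit. -/
def e22 : M3 F := Matrix.single 1 1 1
/-- Matrix unit. -/
def e23 : M3 F := Matrix.single 1 2 1
/-- Matrix unit. -/
def e31 : M3 F := Matrix.single 2 0 1
/-- Matrix unit. -/
def e32 : M3 F := Matrix.single 2 1 1
/-- Matrix unit. -/
def e33 : M3 F := Matrix.single 2 2 1

/-- The linear operator on `M₃(F)` that sends the matrix unit `e_{ij}` to the `(i,j)` entry of
the table `t`. -/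
def ofTable (t : Matrix (Fin 3) (Fin 3) (M3 F)) : Module.End F (M3 F) where
  toFun x := ∑ i, ∑ j, x i j • t i j
  map_add' x y := by simp [add_smul, Finset.sum_add_distrib]
  map_smul' c x := by simp [mul_smul, Finset.smul_sum]

/-- The extension to `M₃(F)` of a linear operator `P` on the diagonal subalgebra `F³`:
it is zero on strictly upper triangular matrices, minus the identity on strictly lower triangular
matrices, and `P` on diagonal matrices. -/
def primitive (P : Module.End F (Fin 3 → F)) : Module.End F (M3 F) where
  toFun x := Matrix.diagonal (P x.diag) - Matrix.of (fun i j => if j < i then x i j else 0)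
  map_add' x y := by
    ext i j
    by_cases hij : i = j <;> by_cases hlt : j < i <;>
      simp [Matrix.diagonal_apply, hij, hlt] <;> ring
  map_smul' c x := by
    ext i j
    by_cases hij : i = j <;> by_cases hlt : j < i <;>
      simp [Matrix.diagonal_apply, hij, hlt]

/-- The operator on `F³ = F f₁ ⊕ F f₂ ⊕ F f₃` for which `R(f_i)` is the `i`-th row of `m`. -/
def ofRows (m : Matrix (Fin 3) (Fin 3) F) : Module.End F (Fin 3 → F) :=
  Matrix.vecMulLinear m

/-! The seven operators on `F³`; the `i`-th row of the matrix lists the coordinates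
of `R(f_i)`. -/

/-- `R(f₁) = f₂ + f₃`, `R(f₂) = f₃`, `R(f₃) = 0`. -/
def rows1 : Matrix (Fin 3) (Fin 3) F := !![0, 1, 1; 0, 0, 1; 0, 0, 0]
/-- `R(f₁) = f₂ + f₃`, `R(f₂) = f₃`, `R(f₃) = -f₃`. -/
def rows2 : Matrix (Fin 3) (Fin 3) F := !![0, 1, 1; 0, 0, 1; 0, 0, -1]
/-- `R(f₁) = f₂ + f₃`, `R(f₂) = -(f₂ + f₃)`, `R(f₃) = -f₃`. -/
def rows3 : Matrix (Fin 3) (Fin 3) F := !![0, 1, 1; 0, -1, -1; 0, 0, -1]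
/-- `R(f₁) = f₂ + f₃`, `R(f₂) = -f₂`, `R(f₃) = 0`. -/
def rows4 : Matrix (Fin 3) (Fin 3) F := !![0, 1, 1; 0, -1, 0; 0, 0, 0]
/-- `R(f₁) = f₂ + f₃`, `R(f₂) = 0`, `R(f₃) = 0`. -/
def rows5 : Matrix (Fin 3) (Fin 3) F := !![0, 1, 1; 0, 0, 0; 0, 0, 0]
/-- `R(f₁) = f₂`, `R(f₂) = 0`, `R(f₃) = 0`. -/
def rows6 : Matrix (Fin 3) (Fin 3) F := !![0, 1, 0; 0, 0, 0; 0, 0, 0]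
/-- `R(f₁) = f₂`, `R(f₂) = 0`, `R(f₃) = -f₃`. -/
def rows7 : Matrix (Fin 3) (Fin 3) F := !![0, 1, 0; 0, 0, 0; 0, 0, -1]

/-- The primitive operator of type `a`. -/
def primA (m : Matrix (Fin 3) (Fin 3) F) : Module.End F (M3 F) :=
  primitive (ofRows m)

/-- The primitive operator of type `b`: the diagonal action is conjugated with the
transposition of the first two coordinates. -/
def primB (m : Matrix (Fin 3) (Fin 3) F) : Module.End F (M3 F) :=
  primitive (ofRows (m.submatrix (Equiv.swap 0 1) (Equiv.swap 0 1)))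

/-- The primitive operator of type `c`: the diagonal action is conjugated with the
transposition of the last two coordinates. -/
def primC (m : Matrix (Fin 3) (Fin 3) F) : Module.End F (M3 F) :=
  primitive (ofRows (m.submatrix (Equiv.swap 1 2) (Equiv.swap 1 2)))

/-- The labels of the 36 operators. -/
inductive Case : Type
  | c1a | c1b | c1c
  | c2a | c2b | c2c
  | c3a | c3b | c3c
  | c4a | c4b | c4c
  | c5a | c5b
  | c6a | c6b | c6c
  | c7a | c7b | c7c
  | c1_I
  | c6_I | c6_II | c6_III
  | c2_I | c2_II
  | c3_I | c3_II
  | c4_I | c4_II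
  | c5_I | c5_II
  | c6_IV | c6_V | c6_VI
  | c8_I

variable (F) in
/-- The 36 operators. In each table the `(i,j)` entry is the image of `e_{ij}`. -/
def listed : Case → Module.End F (M3 F)
  | .c1a => primA rows1
  | .c1b => primB rows1
  | .c1c => primC rows1
  | .c2a => primA rows2
  | .c2b => primB rows2
  | .c2c => primC rows2
  | .c3a => primA rows3
  | .c3b => primB rows3
  | .c3c => primC rows3
  | .c4a => primA rows4
  | .c4b => primB rows4
  | .c4c => primC rows4
  | .c5a => primA rows5
  | .c5b => primB rows5
  | .c6a => primA rows6
  | .c6b => primB rows6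
  | .c6c => primC rows6
  | .c7a => primA rows7
  | .c7b => primB rows7
  | .c7c => primC rows7
  | .c1_I => ofTable
      !![e22 + e33, -e12, -e13;
         -e32, e33, e12 - e23;
         0, 0, 0]
  | .c6_I => ofTable
      !![e22, -e12 - e32, e11 + e22 - e13;
         -e21 + e23, 0, 0;
         -e31 + e33, 0, 0]
  | .c6_II => ofTable
      !![e22, 0, 0;
         -e21, 0, 0;
         -e31 + e11 + e22, 0, 0]
  | .c6_III => ofTable
      !![e22, 0, 0;
         -e21 - e23, 0, 0;
         -e31 + e11 + e22, 0, 0]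
  | .c2_I => ofTable
      !![e22 + e33, -e12, -e13;
         0, e33, -e23;
         0, e33, -e33]
  | .c2_II => ofTable
      !![e22 + e33, -e12, -e13;
         0, e33, e33;
         0, -e32, -e33]
  | .c3_I => ofTable
      !![-e11, -e12, -e13;
         0, -(e11 + e22), -e23;
         0, e11 + e22, e11 + e22]
  | .c3_II => ofTable
      !![-e11, -e12, -e13;
         0, -(e11 + e22), e11 + e22;
         0, -e32, e11 + e22]
  | .c4_I => ofTable
      !![0, -e12, -e13;
         0, e11 + e33, e33;
         0, -e32, -e33]
  | .c4_II => ofTable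
      !![0, -e12, -e13;
         0, e11 + e33, -e23;
         0, e33, -e33]
  | .c5_I => ofTable
      !![e22 + e33, -e12, -e13;
         0, 0, 0;
         0, 0, 0]
  | .c5_II => ofTable
      !![e22 + e33, -e12, -e13;
         0, 0, 0;
         0, e33 - e32, 0]
  | .c6_IV => ofTable
      !![0, -e12, -e13;
         0, e11, -e23 + e11 + e22;
         0, 0, 0]
  | .c6_V => ofTable
      !![0, -e12, -e13;
         0, e11, 0;
         0, -e32 + e11 + e22, 0]
  | .c6_VI => ofTable
      !![e22, -e12, -e13;
         0, 0, 0;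
         0, 0, 0]
  | .c8_I => ofTable
      !![-e11, -e12, -e13;
         0, 0, 0;
         0, e11 + e22 - e32, 0]

end RotaBaxter

/-! All 36 operators have integer coefficients on the matrix units, so each is encoded by a table of
integers (`model`, `listed_eq_toOp`). The Rota–Baxter identity is bilinear, hence a finite integer
computation on pairs of matrix units (`list_all_isRB`, `isRotaBaxter_toOp`).

Orbits are separated by invariants. Automorphisms of M₃(F) and the transpose are multiplicative or
antimultiplicative and preserve the unit and the trace form. Conjugating `P` by such a map therefore
also conjugates its trace-form adjoint P* and every word in P, P + 1, P*, P* + 1. Consequently tr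
P(1), tr P(P*(P(1))) and the identical vanishing of expressions w₁(x)(w(1) + c)w₂(y) are conjugation
invariants (`Conj.signature_eq`). In characteristic zero they can be read off the integer tables.

The map φ is removed by normalization. It commutes with conjugation, is an involution and sends t =
tr P(1) to -t - 3, so an operator with integral t can be replaced by the one of P, φ(P) for which t
≥ -1. Two normalized operators in one orbit are then conjugate without φ
(`conj_of_phiConj_normalize`), and the 36 normalized signatures are distinct (`nodup_signature`). -/

namespace RotaBaxter

/-! ### Integer arithmetic for operators on 3 × 3 matrices -/

/-- A `3 × 3` array, stored in nine fields so that the kernel can compute with it. -/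
structure Nine (α : Type) where
  (a b c d e f g h i : α)

namespace Nine

variable {α β : Type}

/-- The entry in row `i` and column `j`. -/
def get (v : Nine α) : Fin 3 → Fin 3 → α
  | 0, 0 => v.a | 0, 1 => v.b | 0, 2 => v.c
  | 1, 0 => v.d | 1, 1 => v.e | 1, 2 => v.f
  | 2, 0 => v.g | 2, 1 => v.h | 2, 2 => v.i

/-- The array with given entries. -/
def mk' (f : Fin 3 → Fin 3 → α) : Nine α :=
  ⟨f 0 0, f 0 1, f 0 2, f 1 0, f 1 1, f 1 2, f 2 0, f 2 1, f 2 2⟩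

/-- Apply a function to all entries. -/
def map (φ : α → β) (v : Nine α) : Nine β :=
  ⟨φ v.a, φ v.b, φ v.c, φ v.d, φ v.e, φ v.f, φ v.g, φ v.h, φ v.i⟩

/-- Whether all entries satisfy a test. -/
def all (p : α → Bool) (v : Nine α) : Bool :=
  p v.a && p v.b && p v.c && p v.d && p v.e && p v.f && p v.g && p v.h && p v.i

theorem get_mk' (f : Fin 3 → Fin 3 → α) (i j : Fin 3) : (mk' f).get i j = f i j := by
  fin_cases i <;> fin_cases j <;> rfl

theorem get_map (φ : α → β) (v : Nine α) (i j : Fin 3) : (v.map φ).get i j = φ (v.get i j) := by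
  fin_cases i <;> fin_cases j <;> rfl

theorem all_iff (p : α → Bool) (v : Nine α) : v.all p = true ↔ ∀ i j, p (v.get i j) = true := by
  simp [all, get, Fin.forall_fin_succ, and_assoc]

end Nine

/-- Integer `3 × 3` matrices. -/
abbrev IMat : Type := Nine ℤ

namespace IMat

/-- Sum of integer matrices. -/
def add (u v : IMat) : IMat :=
  ⟨u.a + v.a, u.b + v.b, u.c + v.c, u.d + v.d, u.e + v.e, u.f + v.f, u.g + v.g, u.h + v.h,
    u.i + v.i⟩

/-- Product of integer matrices. -/
def mul (u v : IMat) : IMat :=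
  ⟨u.a * v.a + u.b * v.d + u.c * v.g, u.a * v.b + u.b * v.e + u.c * v.h,
    u.a * v.c + u.b * v.f + u.c * v.i, u.d * v.a + u.e * v.d + u.f * v.g,
    u.d * v.b + u.e * v.e + u.f * v.h, u.d * v.c + u.e * v.f + u.f * v.i,
    u.g * v.a + u.h * v.d + u.i * v.g, u.g * v.b + u.h * v.e + u.i * v.h,
    u.g * v.c + u.h * v.f + u.i * v.i⟩

/-- Integer multiples of an integer matrix. -/
def smul (n : ℤ) (v : IMat) : IMat := v.map (n * ·)

/-- The scalar integer matrices. -/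
def scalar (n : ℤ) : IMat := ⟨n, 0, 0, 0, n, 0, 0, 0, n⟩

/-- The trace of an integer matrix. -/
def tr (v : IMat) : ℤ := v.a + v.e + v.i

/-- Whether an integer matrix is zero. -/
def isZero (v : IMat) : Bool := v.all (fun n => decide (n = 0))

/-- The matrix units. -/
def units : Nine IMat :=
  ⟨⟨1, 0, 0, 0, 0, 0, 0, 0, 0⟩, ⟨0, 1, 0, 0, 0, 0, 0, 0, 0⟩, ⟨0, 0, 1, 0, 0, 0, 0, 0, 0⟩,
    ⟨0, 0, 0, 1, 0, 0, 0, 0, 0⟩, ⟨0, 0, 0, 0, 1, 0, 0, 0, 0⟩, ⟨0, 0, 0, 0, 0, 1, 0, 0, 0⟩,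
    ⟨0, 0, 0, 0, 0, 0, 1, 0, 0⟩, ⟨0, 0, 0, 0, 0, 0, 0, 1, 0⟩, ⟨0, 0, 0, 0, 0, 0, 0, 0, 1⟩⟩

/-- Add a multiple of a matrix, skipping zero multiples. -/
def addSmul (n : ℤ) (v w : IMat) : IMat := if n = 0 then w else add (smul n v) w

end IMat

/-- Integer tables of linear operators: the `(i,j)` entry is the image of `e_{ij}`. -/
abbrev IOp : Type := Nine IMat

namespace IOp

open IMat

/-- Apply an operator. -/
def app (M : IOp) (v : IMat) : IMat :=
  addSmul v.a M.a (addSmul v.b M.b (addSmul v.c M.c (addSmul v.d M.d (addSmul v.e M.e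
    (addSmul v.f M.f (addSmul v.g M.g (addSmul v.h M.h (addSmul v.i M.i (scalar 0)))))))))

/-- Composition of operators. -/
def comp (M N : IOp) : IOp := N.map M.app

/-- The operator `M + id`. -/
def succ (M : IOp) : IOp :=
  ⟨add units.a M.a, add units.b M.b, add units.c M.c, add units.d M.d, add units.e M.e,
    add units.f M.f, add units.g M.g, add units.h M.h, add units.i M.i⟩

/-- The operator `-M - id`. -/
def flip (M : IOp) : IOp := M.succ.map (smul (-1))

/-- The adjoint with respect to the trace form. -/
def adj (M : IOp) : IOp :=
  .mk' fun a b => .mk' fun i j => (M.get j i).get b a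

end IOp

/-! ### Words, forms and the signature -/

/-- The operators built from `P` that occur as letters of words: `P`, `P + id`, and the adjoints
of these with respect to the trace form. -/
inductive Letter : Type
  | op | opSucc | adj | adjSucc

/-- The expression `w₁(x) (w(1) + c) w₂(y)` in an operator; the `w`'s are words of letters. -/
structure Form where
  /-- the word applied to the first variable -/
  left : List Letter
  /-- the word applied to the unit -/
  mid : List Letter
  /-- the scalar shift of the middle factor -/
  shift : ℤ
  /-- the word applied to the second variable -/
  right : List Letter

namespace IOp

open IMat

/-- The integer table of a letter. -/
def letter (M : IOp) : Letter → IOp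
  | .op => M
  | .opSucc => M.succ
  | .adj => M.adj
  | .adjSucc => M.adj.succ

/-- The integer table of a word. -/
def word (M : IOp) (w : List Letter) : IOp :=
  w.foldr (fun l N => (M.letter l).comp N) units

/-- The middle factor of a form. -/
def mid (M : IOp) (f : Form) : IMat := add ((M.word f.mid).app (scalar 1)) (scalar f.shift)

/-- Whether all products `u m v` with `u` in the first and `v` in the second table vanish. -/
def kills (m : IMat) (U V : IOp) : Bool :=
  U.all fun u => let um := mul u m; isZero um || V.all fun v => isZero (mul um v)

/-- Whether a form vanishes identically, in either order of its outer words. -/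
def vanishes (M : IOp) (f : Form) : Bool :=
  let m := M.mid f
  let U := M.word f.left
  let V := M.word f.right
  kills m U V && kills m V U

/-- The trace of the image of the unit. -/
def tr₁ (M : IOp) : ℤ := (M.app (scalar 1)).tr

/-- The trace of the image of the unit under the operator, its adjoint and the operator. -/
def tr₃ (M : IOp) : ℤ := (M.app (M.adj.app (M.app (scalar 1)))).tr

/-- Replace an operator `P` by `-P - id` if `tr P(1)` is less than `-1`. -/
def normalize (M : IOp) : IOp := if -1 ≤ M.tr₁ then M else M.flip

/-- Whether the Rota-Baxter identity of weight one holds. -/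
def isRB (M : IOp) : Bool :=
  (Nine.mk' fun i j => (i, j)).all fun p => (Nine.mk' fun i j => (i, j)).all fun q =>
    let x := units.get p.1 p.2
    let y := units.get q.1 q.2
    let Mx := M.get p.1 p.2
    let My := M.get q.1 q.2
    isZero (add (mul Mx My) (smul (-1) (M.app (add (add (mul Mx y) (mul x My)) (mul x y)))))

end IOp

open Letter in
/-- Forms that, together with two traces, separate the orbits of the listed operators. -/
def forms : List Form :=
  [⟨[op, op], [adjSucc, opSucc], 0, [op, op]⟩,
   ⟨[op, op], [adjSucc, adj], 0, [op, op]⟩,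
   ⟨[op], [adj, adj], 0, [op]⟩,
   ⟨[adj, op], [adjSucc, opSucc], 0, [op, adj]⟩,
   ⟨[adj], [adjSucc, op], -1, [adj]⟩,
   ⟨[adjSucc, opSucc], [adj], -1, [op, adj]⟩,
   ⟨[adjSucc], [op], 0, [adjSucc]⟩,
   ⟨[], [adj, adj], 0, [op, adj]⟩]

/-- The list of all invariants used to separate orbits. -/
def IOp.signature (M : IOp) : List ℤ :=
  M.tr₁ :: M.tr₃ :: forms.map fun f => if M.vanishes f then 1 else 0

/-! ### Tables of the 36 operators and the finite computations -/

/-- The integer table of the primitive operator with diagonal action given by `m`. -/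
def IOp.prim (m : IMat) : IOp :=
  ⟨⟨m.a, 0, 0, 0, m.b, 0, 0, 0, m.c⟩, .scalar 0, .scalar 0,
    ⟨0, 0, 0, -1, 0, 0, 0, 0, 0⟩, ⟨m.d, 0, 0, 0, m.e, 0, 0, 0, m.f⟩, .scalar 0,
    ⟨0, 0, 0, 0, 0, 0, -1, 0, 0⟩, ⟨0, 0, 0, 0, 0, 0, 0, -1, 0⟩, ⟨m.g, 0, 0, 0, m.h, 0, 0, 0, m.i⟩⟩

/-- The integer tables of the listed operators. -/
def model : Case → IOp
  | .c1a => .prim ⟨0, 1, 1, 0, 0, 1, 0, 0, 0⟩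
  | .c1b => .prim ⟨0, 0, 1, 1, 0, 1, 0, 0, 0⟩
  | .c1c => .prim ⟨0, 1, 1, 0, 0, 0, 0, 1, 0⟩
  | .c2a => .prim ⟨0, 1, 1, 0, 0, 1, 0, 0, -1⟩
  | .c2b => .prim ⟨0, 0, 1, 1, 0, 1, 0, 0, -1⟩
  | .c2c => .prim ⟨0, 1, 1, 0, -1, 0, 0, 1, 0⟩
  | .c3a => .prim ⟨0, 1, 1, 0, -1, -1, 0, 0, -1⟩
  | .c3b => .prim ⟨-1, 0, -1, 1, 0, 1, 0, 0, -1⟩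
  | .c3c => .prim ⟨0, 1, 1, 0, -1, 0, 0, -1, -1⟩
  | .c4a => .prim ⟨0, 1, 1, 0, -1, 0, 0, 0, 0⟩
  | .c4b => .prim ⟨-1, 0, 0, 1, 0, 1, 0, 0, 0⟩
  | .c4c => .prim ⟨0, 1, 1, 0, 0, 0, 0, 0, -1⟩
  | .c5a => .prim ⟨0, 1, 1, 0, 0, 0, 0, 0, 0⟩
  | .c5b => .prim ⟨0, 0, 0, 1, 0, 1, 0, 0, 0⟩
  | .c6a => .prim ⟨0, 1, 0, 0, 0, 0, 0, 0, 0⟩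
  | .c6b => .prim ⟨0, 0, 0, 1, 0, 0, 0, 0, 0⟩
  | .c6c => .prim ⟨0, 0, 1, 0, 0, 0, 0, 0, 0⟩
  | .c7a => .prim ⟨0, 1, 0, 0, 0, 0, 0, 0, -1⟩
  | .c7b => .prim ⟨0, 0, 0, 1, 0, 0, 0, 0, -1⟩
  | .c7c => .prim ⟨0, 0, 1, 0, -1, 0, 0, 0, 0⟩
  | .c1_I => ⟨
      ⟨0, 0, 0, 0, 1, 0, 0, 0, 1⟩, ⟨0, -1, 0, 0, 0, 0, 0, 0, 0⟩, ⟨0, 0, -1, 0, 0, 0, 0, 0, 0⟩,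
      ⟨0, 0, 0, 0, 0, 0, 0, -1, 0⟩, ⟨0, 0, 0, 0, 0, 0, 0, 0, 1⟩, ⟨0, 1, 0, 0, 0, -1, 0, 0, 0⟩,
      .scalar 0, .scalar 0, .scalar 0⟩
  | .c6_I => ⟨
      ⟨0, 0, 0, 0, 1, 0, 0, 0, 0⟩, ⟨0, -1, 0, 0, 0, 0, 0, -1, 0⟩, ⟨1, 0, -1, 0, 1, 0, 0, 0, 0⟩,
      ⟨0, 0, 0, -1, 0, 1, 0, 0, 0⟩, .scalar 0, .scalar 0,
      ⟨0, 0, 0, 0, 0, 0, -1, 0, 1⟩, .scalar 0, .scalar 0⟩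
  | .c6_II => ⟨
      ⟨0, 0, 0, 0, 1, 0, 0, 0, 0⟩, .scalar 0, .scalar 0,
      ⟨0, 0, 0, -1, 0, 0, 0, 0, 0⟩, .scalar 0, .scalar 0,
      ⟨1, 0, 0, 0, 1, 0, -1, 0, 0⟩, .scalar 0, .scalar 0⟩
  | .c6_III => ⟨
      ⟨0, 0, 0, 0, 1, 0, 0, 0, 0⟩, .scalar 0, .scalar 0,
      ⟨0, 0, 0, -1, 0, -1, 0, 0, 0⟩, .scalar 0, .scalar 0,
      ⟨1, 0, 0, 0, 1, 0, -1, 0, 0⟩, .scalar 0, .scalar 0⟩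
  | .c2_I => ⟨
      ⟨0, 0, 0, 0, 1, 0, 0, 0, 1⟩, ⟨0, -1, 0, 0, 0, 0, 0, 0, 0⟩, ⟨0, 0, -1, 0, 0, 0, 0, 0, 0⟩,
      .scalar 0, ⟨0, 0, 0, 0, 0, 0, 0, 0, 1⟩, ⟨0, 0, 0, 0, 0, -1, 0, 0, 0⟩,
      .scalar 0, ⟨0, 0, 0, 0, 0, 0, 0, 0, 1⟩, ⟨0, 0, 0, 0, 0, 0, 0, 0, -1⟩⟩
  | .c2_II => ⟨
      ⟨0, 0, 0, 0, 1, 0, 0, 0, 1⟩, ⟨0, -1, 0, 0, 0, 0, 0, 0, 0⟩, ⟨0, 0, -1, 0, 0, 0, 0, 0, 0⟩,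
      .scalar 0, ⟨0, 0, 0, 0, 0, 0, 0, 0, 1⟩, ⟨0, 0, 0, 0, 0, 0, 0, 0, 1⟩,
      .scalar 0, ⟨0, 0, 0, 0, 0, 0, 0, -1, 0⟩, ⟨0, 0, 0, 0, 0, 0, 0, 0, -1⟩⟩
  | .c3_I => ⟨
      ⟨-1, 0, 0, 0, 0, 0, 0, 0, 0⟩, ⟨0, -1, 0, 0, 0, 0, 0, 0, 0⟩, ⟨0, 0, -1, 0, 0, 0, 0, 0, 0⟩,
      .scalar 0, ⟨-1, 0, 0, 0, -1, 0, 0, 0, 0⟩, ⟨0, 0, 0, 0, 0, -1, 0, 0, 0⟩,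
      .scalar 0, ⟨1, 0, 0, 0, 1, 0, 0, 0, 0⟩, ⟨1, 0, 0, 0, 1, 0, 0, 0, 0⟩⟩
  | .c3_II => ⟨
      ⟨-1, 0, 0, 0, 0, 0, 0, 0, 0⟩, ⟨0, -1, 0, 0, 0, 0, 0, 0, 0⟩, ⟨0, 0, -1, 0, 0, 0, 0, 0, 0⟩,
      .scalar 0, ⟨-1, 0, 0, 0, -1, 0, 0, 0, 0⟩, ⟨1, 0, 0, 0, 1, 0, 0, 0, 0⟩,
      .scalar 0, ⟨0, 0, 0, 0, 0, 0, 0, -1, 0⟩, ⟨1, 0, 0, 0, 1, 0, 0, 0, 0⟩⟩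
  | .c4_I => ⟨
      .scalar 0, ⟨0, -1, 0, 0, 0, 0, 0, 0, 0⟩, ⟨0, 0, -1, 0, 0, 0, 0, 0, 0⟩,
      .scalar 0, ⟨1, 0, 0, 0, 0, 0, 0, 0, 1⟩, ⟨0, 0, 0, 0, 0, 0, 0, 0, 1⟩,
      .scalar 0, ⟨0, 0, 0, 0, 0, 0, 0, -1, 0⟩, ⟨0, 0, 0, 0, 0, 0, 0, 0, -1⟩⟩
  | .c4_II => ⟨
      .scalar 0, ⟨0, -1, 0, 0, 0, 0, 0, 0, 0⟩, ⟨0, 0, -1, 0, 0, 0, 0, 0, 0⟩,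
      .scalar 0, ⟨1, 0, 0, 0, 0, 0, 0, 0, 1⟩, ⟨0, 0, 0, 0, 0, -1, 0, 0, 0⟩,
      .scalar 0, ⟨0, 0, 0, 0, 0, 0, 0, 0, 1⟩, ⟨0, 0, 0, 0, 0, 0, 0, 0, -1⟩⟩
  | .c5_I => ⟨
      ⟨0, 0, 0, 0, 1, 0, 0, 0, 1⟩, ⟨0, -1, 0, 0, 0, 0, 0, 0, 0⟩, ⟨0, 0, -1, 0, 0, 0, 0, 0, 0⟩,
      .scalar 0, .scalar 0, .scalar 0,
      .scalar 0, .scalar 0, .scalar 0⟩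
  | .c5_II => ⟨
      ⟨0, 0, 0, 0, 1, 0, 0, 0, 1⟩, ⟨0, -1, 0, 0, 0, 0, 0, 0, 0⟩, ⟨0, 0, -1, 0, 0, 0, 0, 0, 0⟩,
      .scalar 0, .scalar 0, .scalar 0,
      .scalar 0, ⟨0, 0, 0, 0, 0, 0, 0, -1, 1⟩, .scalar 0⟩
  | .c6_IV => ⟨
      .scalar 0, ⟨0, -1, 0, 0, 0, 0, 0, 0, 0⟩, ⟨0, 0, -1, 0, 0, 0, 0, 0, 0⟩,
      .scalar 0, ⟨1, 0, 0, 0, 0, 0, 0, 0, 0⟩, ⟨1, 0, 0, 0, 1, -1, 0, 0, 0⟩,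
      .scalar 0, .scalar 0, .scalar 0⟩
  | .c6_V => ⟨
      .scalar 0, ⟨0, -1, 0, 0, 0, 0, 0, 0, 0⟩, ⟨0, 0, -1, 0, 0, 0, 0, 0, 0⟩,
      .scalar 0, ⟨1, 0, 0, 0, 0, 0, 0, 0, 0⟩, .scalar 0,
      .scalar 0, ⟨1, 0, 0, 0, 1, 0, 0, -1, 0⟩, .scalar 0⟩
  | .c6_VI => ⟨
      ⟨0, 0, 0, 0, 1, 0, 0, 0, 0⟩, ⟨0, -1, 0, 0, 0, 0, 0, 0, 0⟩, ⟨0, 0, -1, 0, 0, 0, 0, 0, 0⟩,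
      .scalar 0, .scalar 0, .scalar 0,
      .scalar 0, .scalar 0, .scalar 0⟩
  | .c8_I => ⟨
      ⟨-1, 0, 0, 0, 0, 0, 0, 0, 0⟩, ⟨0, -1, 0, 0, 0, 0, 0, 0, 0⟩, ⟨0, 0, -1, 0, 0, 0, 0, 0, 0⟩,
      .scalar 0, .scalar 0, .scalar 0,
      .scalar 0, ⟨1, 0, 0, 0, 1, 0, 0, -1, 0⟩, .scalar 0⟩

/-- All labels. -/
def Case.list : List Case :=
  [.c1a, .c1b, .c1c, .c2a, .c2b, .c2c, .c3a, .c3b, .c3c, .c4a, .c4b, .c4c, .c5a, .c5b,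
    .c6a, .c6b, .c6c, .c7a, .c7b, .c7c, .c1_I, .c6_I, .c6_II, .c6_III, .c2_I, .c2_II, .c3_I, .c3_II,
    .c4_I, .c4_II, .c5_I, .c5_II, .c6_IV, .c6_V, .c6_VI, .c8_I]

theorem Case.mem_list (c : Case) : c ∈ Case.list := by
  cases c <;> simp [Case.list]

theorem list_all_isRB : (Case.list.all fun c => (model c).isRB) = true := by
  decide +kernel

/-- The bound -1 is the right threshold because φ acts on this integer by t ↦ -t - 3, which
exchanges t ≥ -1 with t ≤ -2 and has no integral fixed point. -/
theorem list_all_tr₁ : (Case.list.all fun c => decide (-1 ≤ (model c).normalize.tr₁)) = true := by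
  decide +kernel

/-- The computational core of the separation: two traces and eight vanishing bits tell all 36 cases
apart. -/
theorem nodup_signature : (Case.list.map fun c => (model c).normalize.signature).Nodup := by
  decide +kernel

/-! ### Passage from integer tables to operators over F -/

variable {F : Type*} [Field F]

/-- The matrix over `F` given by an integer matrix. -/
def toMat (v : IMat) : M3 F := Matrix.of fun i j => ((v.get i j : ℤ) : F)

/-- The linear operator on `M₃(F)` given by an integer table. -/
def toOp (M : IOp) : Module.End F (M3 F) := ofTable (Matrix.of fun i j => toMat (M.get i j))

theorem toMat_apply (v : IMat) (i j : Fin 3) : (toMat v : M3 F) i j = ((v.get i j : ℤ) : F) := rfl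

theorem toMat_add (u v : IMat) : (toMat (u.add v) : M3 F) = toMat u + toMat v := by
  ext i j
  fin_cases i <;> fin_cases j <;> simp [toMat, Nine.get, IMat.add]

theorem toMat_mul (u v : IMat) : (toMat (u.mul v) : M3 F) = toMat u * toMat v := by
  ext i j
  fin_cases i <;> fin_cases j <;>
    simp [toMat, Nine.get, IMat.mul, Matrix.mul_apply, Fin.sum_univ_three]

theorem toMat_smul (n : ℤ) (v : IMat) : (toMat (v.smul n) : M3 F) = (n : F) • toMat v := by
  ext i j
  simp [toMat, IMat.smul, Nine.get_map]

theorem toMat_scalar (n : ℤ) : (toMat (.scalar n) : M3 F) = (n : F) • (1 : M3 F) := by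
  ext i j
  fin_cases i <;> fin_cases j <;> simp [toMat, Nine.get, IMat.scalar]

theorem toMat_units (i j : Fin 3) : (toMat (IMat.units.get i j) : M3 F) = Matrix.single i j 1 := by
  ext k l
  fin_cases i <;> fin_cases j <;> fin_cases k <;> fin_cases l <;>
    simp [toMat, Nine.get, IMat.units]

theorem trace_toMat (v : IMat) : (toMat v : M3 F).trace = ((v.tr : ℤ) : F) := by
  simp [toMat, Nine.get, IMat.tr, Matrix.trace, Fin.sum_univ_three]

theorem isZero_iff [CharZero F] (v : IMat) : v.isZero = true ↔ (toMat v : M3 F) = 0 := by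
  simp [IMat.isZero, Nine.all_iff, ← Matrix.ext_iff, toMat_apply]

theorem toMat_addSmul (n : ℤ) (v w : IMat) :
    (toMat (.addSmul n v w) : M3 F) = (n : F) • toMat v + toMat w := by
  unfold IMat.addSmul
  split_ifs with h
  · simp [h]
  · rw [toMat_add, toMat_smul]

theorem toMat_app (M : IOp) (v : IMat) : (toMat (M.app v) : M3 F) = toOp M (toMat v) := by
  simp only [IOp.app, toMat_addSmul, toMat_scalar]
  simp [toOp, ofTable, Fin.sum_univ_three, toMat_apply, Nine.get]
  abel

theorem ofTable_single (t : Matrix (Fin 3) (Fin 3) (M3 F)) (i j : Fin 3) :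
    ofTable t (Matrix.single i j 1) = t i j := by
  fin_cases i <;> fin_cases j <;> simp [ofTable, Fin.sum_univ_three]

theorem toOp_single (M : IOp) (i j : Fin 3) :
    (toOp M : Module.End F (M3 F)) (Matrix.single i j 1) = toMat (M.get i j) :=
  ofTable_single _ i j

/-- Linear maps on `M₃(F)` that agree on matrix units are equal. -/
theorem linearMap_ext_single {V : Type*} [AddCommGroup V] [Module F V] {f g : M3 F →ₗ[F] V}
    (h : ∀ i j, f (Matrix.single i j 1) = g (Matrix.single i j 1)) : f = g :=
  (Matrix.stdBasis F (Fin 3) (Fin 3)).ext fun p => by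
    rw [Matrix.stdBasis_eq_single]
    exact h p.1 p.2

theorem toOp_comp (M N : IOp) :
    (toOp (M.comp N) : Module.End F (M3 F)) = toOp M * toOp N :=
  linearMap_ext_single fun i j => by
    rw [Module.End.mul_apply, toOp_single, toOp_single, IOp.comp, Nine.get_map, toMat_app]

theorem toOp_units : (toOp IMat.units : Module.End F (M3 F)) = 1 :=
  linearMap_ext_single fun i j => by
    rw [Module.End.one_apply, toOp_single, toMat_units]

theorem get_succ (M : IOp) (i j : Fin 3) :
    M.succ.get i j = .add (IMat.units.get i j) (M.get i j) := by
  fin_cases i <;> fin_cases j <;> rfl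

theorem toOp_succ (M : IOp) : (toOp M.succ : Module.End F (M3 F)) = toOp M + 1 :=
  linearMap_ext_single fun i j => by
    rw [LinearMap.add_apply, Module.End.one_apply, toOp_single, toOp_single, get_succ, toMat_add,
      toMat_units, add_comm]

theorem toOp_flip (M : IOp) : (toOp M.flip : Module.End F (M3 F)) = phi 1 (toOp M) :=
  linearMap_ext_single fun i j => by
    rw [toOp_single, IOp.flip, Nine.get_map, toMat_smul, get_succ, toMat_add, toMat_units]
    simp [phi, toOp_single]
    abel

/-! ### Adjoints, words and forms over F -/

/-- The adjoint of an operator on `M₃(F)` with respect to the trace form. -/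
def adj (P : Module.End F (M3 F)) : Module.End F (M3 F) where
  -- The (i,j) entry of a matrix z is tr(z e_{ji}), so the adjoint identity forces this formula.
  toFun x := Matrix.of fun i j => (x * P (Matrix.single j i 1)).trace
  map_add' x y := by ext i j; simp [add_mul]
  map_smul' c x := by ext i j; simp

theorem trace_adj_mul (P : Module.End F (M3 F)) (x y : M3 F) :
    (adj P x * y).trace = (x * P y).trace := by
  have h : (Matrix.traceLinearMap (Fin 3) F F) ∘ₗ (LinearMap.mulLeft F (adj P x)) =
      (Matrix.traceLinearMap (Fin 3) F F) ∘ₗ (LinearMap.mulLeft F x) ∘ₗ P :=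
    linearMap_ext_single fun i j => by
      simp [Matrix.trace_mul_single, adj]
  simpa using LinearMap.congr_fun h y

theorem toOp_adj (M : IOp) : (toOp M.adj : Module.End F (M3 F)) = adj (toOp M) :=
  linearMap_ext_single fun a b => by
    ext i j
    simp [toOp_single, adj, Matrix.trace_single_mul, IOp.adj, Nine.get_mk', toMat_apply]

/-- The operator of a letter. -/
def Letter.apply (P : Module.End F (M3 F)) : Letter → Module.End F (M3 F)
  | .op => P
  | .opSucc => P + 1
  | .adj => RotaBaxter.adj P
  | .adjSucc => RotaBaxter.adj P + 1

/-- The operator of a word. -/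
def wordOp (P : Module.End F (M3 F)) (w : List Letter) : Module.End F (M3 F) :=
  w.foldr (fun l Q => l.apply P * Q) 1

theorem toOp_word (M : IOp) (w : List Letter) :
    (toOp (M.word w) : Module.End F (M3 F)) = wordOp (toOp M) w := by
  induction w with
  | nil => exact toOp_units
  | cons l w ih =>
    change toOp ((M.letter l).comp (M.word w)) = l.apply (toOp M) * wordOp (toOp M) w
    rw [toOp_comp, ih]
    cases l <;> simp [IOp.letter, Letter.apply, toOp_succ, toOp_adj]

/-- The middle factor of a form. -/
def Form.midFactor (f : Form) (P : Module.End F (M3 F)) : M3 F :=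
  wordOp P f.mid 1 + (f.shift : F) • (1 : M3 F)

/-- A form vanishes identically, in either order of its outer words. -/
def Form.Vanishes (f : Form) (P : Module.End F (M3 F)) : Prop :=
  (∀ x y, wordOp P f.left x * f.midFactor P * wordOp P f.right y = 0) ∧
    ∀ x y, wordOp P f.right x * f.midFactor P * wordOp P f.left y = 0

theorem toMat_mid (M : IOp) (f : Form) : (toMat (M.mid f) : M3 F) = f.midFactor (toOp M) := by
  simp [IOp.mid, Form.midFactor, toMat_add, toMat_app, toMat_scalar, toOp_word]

theorem kills_iff [CharZero F] (m : IMat) (U V : IOp) : IOp.kills m U V = true ↔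
    ∀ x y, (toOp U x : M3 F) * toMat m * toOp V y = 0 := by
  have key : IOp.kills m U V = true ↔ ∀ i j k l,
      (toMat (U.get i j) : M3 F) * toMat m * toMat (V.get k l) = 0 := by
    simp only [IOp.kills, Nine.all_iff, Bool.or_eq_true, isZero_iff (F := F), toMat_mul]
    refine forall₂_congr fun i j => ⟨?_, fun h => Or.inr h⟩
    -- The early exit for u m = 0 only saves work: every product u m v is then zero.
    rintro (h | h) k l
    · rw [h, zero_mul]
    · exact h k l
  rw [key]
  refine ⟨fun h => ?_, fun h i j k l => ?_⟩
  swap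
  · simpa only [toOp_single] using h (Matrix.single i j 1) (Matrix.single k l 1)
  -- As a bilinear map, the expression is determined by its values on pairs of matrix units.
  have hb : (LinearMap.mul F (M3 F)).compl₁₂
      ((LinearMap.mulRight F (toMat m)).comp (toOp U)) (toOp V) = 0 := by
    refine linearMap_ext_single fun i j => linearMap_ext_single fun k l => ?_
    simpa [toOp_single] using h i j k l
  intro x y
  simpa using LinearMap.congr_fun₂ hb x y

theorem vanishes_iff [CharZero F] (M : IOp) (f : Form) :
    M.vanishes f = true ↔ f.Vanishes (toOp M : Module.End F (M3 F)) := by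
  simp [IOp.vanishes, Form.Vanishes, kills_iff (F := F), toMat_mid, toOp_word]

theorem trace_toOp_one (M : IOp) :
    ((toOp M : Module.End F (M3 F)) 1).trace = ((M.tr₁ : ℤ) : F) := by
  rw [IOp.tr₁, ← trace_toMat, toMat_app, toMat_scalar, Int.cast_one, one_smul]

theorem trace_toOp_adj_toOp_one (M : IOp) :
    ((toOp M : Module.End F (M3 F)) (adj (toOp M) (toOp M 1))).trace = ((M.tr₃ : ℤ) : F) := by
  rw [IOp.tr₃, ← trace_toMat, toMat_app, toMat_app, toMat_app, toMat_scalar, Int.cast_one,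
    one_smul, toOp_adj]

theorem isRotaBaxter_toOp (M : IOp) (h : M.isRB = true) :
    IsRotaBaxter (1 : F) (toOp M) := by
  have hb : (LinearMap.mul F (M3 F)).compl₁₂ (toOp M) (toOp M) =
      ((LinearMap.mul F (M3 F)).compl₁₂ (toOp M) LinearMap.id +
        (LinearMap.mul F (M3 F)).compl₁₂ LinearMap.id (toOp M) +
        LinearMap.mul F (M3 F)).compr₂ (toOp M) := by
    refine linearMap_ext_single fun i j => linearMap_ext_single fun k l => ?_
    have hz : (toMat (.add (.mul (M.get i j) (M.get k l)) (.smul (-1) (M.app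
        (.add (.add (.mul (M.get i j) (IMat.units.get k l)) (.mul (IMat.units.get i j) (M.get k l)))
          (.mul (IMat.units.get i j) (IMat.units.get k l)))))) : M3 F) = 0 := by
      simp only [IOp.isRB, Nine.all_iff, Nine.get_mk'] at h
      have h0 := h i j k l
      simp only [IMat.isZero, Nine.all_iff, decide_eq_true_eq] at h0
      ext a b
      rw [toMat_apply, h0]
      simp
    simp only [toMat_add, toMat_mul, toMat_smul, toMat_app, toMat_units] at hz
    have hz' := add_eq_zero_iff_eq_neg.mp hz
    simp only [LinearMap.compl₁₂_apply, LinearMap.compr₂_apply, LinearMap.add_apply, toOp_single,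
      LinearMap.mul_apply', LinearMap.id_apply]
    simpa [add_comm, add_left_comm] using hz'
  intro x y
  simpa using LinearMap.congr_fun₂ hb x y

/-! ### Identification of the listed operators with their tables -/

theorem toMat_eq (v : IMat) : (toMat v : M3 F) =
    (v.a : F) • e11 + (v.b : F) • e12 + (v.c : F) • e13 + (v.d : F) • e21 + (v.e : F) • e22 +
      (v.f : F) • e23 + (v.g : F) • e31 + (v.h : F) • e32 + (v.i : F) • e33 := by
  ext i j
  fin_cases i <;> fin_cases j <;>
    simp [toMat, Nine.get, e11, e12, e13, e21, e22, e23, e31, e32, e33]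

theorem toOp_prim (m : IMat) (r : Matrix (Fin 3) (Fin 3) F)
    (h : ∀ i j, r i j = ((m.get i j : ℤ) : F)) : primitive (ofRows r) = toOp (.prim m) := by
  refine linearMap_ext_single fun i j => ?_
  rw [toOp_single]
  ext k l
  fin_cases i <;> fin_cases j <;> fin_cases k <;> fin_cases l <;>
    simp [primitive, ofRows, IOp.prim, toMat, Nine.get, IMat.scalar, h, Matrix.single_apply]

theorem ofTable_eq_toOp {t : Matrix (Fin 3) (Fin 3) (M3 F)} {M : IOp}
    (h : ∀ i j, t i j = toMat (M.get i j)) : ofTable t = toOp M :=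
  congrArg ofTable (Matrix.ext h)

set_option maxHeartbeats 1000000 in
theorem listed_eq_toOp (c : Case) : listed F c = toOp (model c) := by
  cases c
  -- The first 20 constructors are the primitive operators; the remaining 16 are given by explicit
  -- tables.
  iterate 20
    refine toOp_prim _ _ fun i j => ?_
    fin_cases i <;> fin_cases j <;>
      simp [rows1, rows2, rows3, rows4, rows5, rows6, rows7, Nine.get, Matrix.submatrix,
        Equiv.swap_apply_def]
  all_goals
    refine ofTable_eq_toOp fun i j => ?_
    rw [toMat_eq]
    fin_cases i <;> fin_cases j <;> simp [model, Nine.get, IMat.scalar] <;> abel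

/-! ### Symmetries of the matrix algebra and invariance of the signature -/

/-- A linear bijection of `M₃(F)` that is multiplicative or antimultiplicative and preserves the
unit and the trace. -/
structure IsSymmetry (α : M3 F ≃ₗ[F] M3 F) : Prop where
  map_one : α 1 = 1
  trace_eq : ∀ x, (α x).trace = x.trace
  map_mul_or : (∀ x y, α (x * y) = α x * α y) ∨ ∀ x y, α (x * y) = α y * α x

namespace IsSymmetry

variable {α β : M3 F ≃ₗ[F] M3 F}

theorem refl : IsSymmetry (LinearEquiv.refl F (M3 F)) :=
  ⟨rfl, fun _ => rfl, Or.inl fun _ _ => rfl⟩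

theorem symm (h : IsSymmetry α) : IsSymmetry α.symm where
  map_one := by rw [LinearEquiv.symm_apply_eq, h.map_one]
  trace_eq x := by rw [← h.trace_eq, LinearEquiv.apply_symm_apply]
  map_mul_or := h.map_mul_or.imp
    (fun hm x y => by simp [LinearEquiv.symm_apply_eq, hm])
    (fun hm x y => by simp [LinearEquiv.symm_apply_eq, hm])

theorem trans (h : IsSymmetry α) (k : IsSymmetry β) : IsSymmetry (α.trans β) where
  map_one := by simp [h.map_one, k.map_one]
  trace_eq x := by simp [h.trace_eq, k.trace_eq]
  map_mul_or := by
    rcases h.map_mul_or with h | h <;> rcases k.map_mul_or with k | k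
    · exact Or.inl fun x y => by simp [h, k]
    · exact Or.inr fun x y => by simp [h, k]
    · exact Or.inr fun x y => by simp [h, k]
    · exact Or.inl fun x y => by simp [h, k]

theorem trace_mul (h : IsSymmetry α) (x y : M3 F) : (α x * α y).trace = (x * y).trace := by
  rcases h.map_mul_or with hm | hm
  · rw [← hm, h.trace_eq]
  · rw [← hm, h.trace_eq, Matrix.trace_mul_comm]

/-- Automorphisms of M₃(F) are inner, hence preserve the trace. -/
theorem of_algEquiv (ψ : M3 F ≃ₐ[F] M3 F) : IsSymmetry ψ.toLinearEquiv :=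
  ⟨_root_.map_one ψ, fun x => Matrix.trace_map ψ x, Or.inl (_root_.map_mul ψ)⟩

theorem transpose : IsSymmetry (Matrix.transposeLinearEquiv (Fin 3) (Fin 3) F F) :=
  ⟨Matrix.transpose_one, Matrix.trace_transpose, Or.inr Matrix.transpose_mul⟩

end IsSymmetry

/-- `α` intertwines the operators `Q` and `P`. -/
def Intertwines (α : M3 F ≃ₗ[F] M3 F) (P Q : Module.End F (M3 F)) : Prop :=
  ∀ x, α (Q x) = P (α x)

namespace Intertwines

variable {α β : M3 F ≃ₗ[F] M3 F} {P Q S P' Q' : Module.End F (M3 F)}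

theorem symm (h : Intertwines α P Q) : Intertwines α.symm Q P := fun x => by
  rw [LinearEquiv.symm_apply_eq, h, LinearEquiv.apply_symm_apply]

theorem trans (h : Intertwines α P Q) (k : Intertwines β Q S) : Intertwines (β.trans α) P S :=
  fun x => by rw [LinearEquiv.trans_apply, k, h, LinearEquiv.trans_apply]

theorem add_one (h : Intertwines α P Q) : Intertwines α (P + 1) (Q + 1) := fun x => by
  simp [h x]

theorem mul (h : Intertwines α P Q) (k : Intertwines α P' Q') :
    Intertwines α (P * P') (Q * Q') := fun x => by
  simp only [Module.End.mul_apply]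
  rw [h, k]

theorem phi (h : Intertwines α P Q) : Intertwines α (phi 1 P) (phi 1 Q) := fun x => by
  simp [RotaBaxter.phi, h x]

/-- The trace form is nondegenerate and `α` is an isometry for it, so adjoints are transported along
with the operators. -/
theorem adj (h : Intertwines α P Q) (hα : IsSymmetry α) :
    Intertwines α (adj P) (adj Q) := fun x => by
  refine Matrix.ext_iff_trace_mul_right.mpr fun y => ?_
  obtain ⟨z, rfl⟩ := α.surjective y
  rw [hα.trace_mul, trace_adj_mul, trace_adj_mul, ← h, hα.trace_mul]

theorem word (h : Intertwines α P Q) (hα : IsSymmetry α) (w : List Letter) :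
    Intertwines α (wordOp P w) (wordOp Q w) := by
  induction w with
  | nil => exact fun _ => rfl
  | cons l w ih =>
    refine mul ?_ ih
    cases l
    · exact h
    · exact h.add_one
    · exact h.adj hα
    · exact (h.adj hα).add_one

/-- Applying `α` turns the expression for `Q` into the one for `P` at the transported arguments. An
antimultiplicative `α` exchanges the outer factors, which is why `Form.Vanishes` demands both
orders. -/
theorem vanishes (h : Intertwines α P Q) (hα : IsSymmetry α) (f : Form) (hf : f.Vanishes P) :
    f.Vanishes Q := by
  have hm : α (f.midFactor Q) = f.midFactor P := by
    rw [Form.midFactor, map_add, map_smul, h.word hα, hα.map_one, Form.midFactor]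
  have hl := h.word hα f.left
  have hr := h.word hα f.right
  rcases hα.map_mul_or with hmul | hmul
  · refine ⟨fun x y => α.injective ?_, fun x y => α.injective ?_⟩
    · rw [hmul, hmul, hl, hr, hm, hf.1, map_zero]
    · rw [hmul, hmul, hl, hr, hm, hf.2, map_zero]
  · refine ⟨fun x y => α.injective ?_, fun x y => α.injective ?_⟩
    · rw [hmul, hmul, hl, hr, hm, ← mul_assoc, hf.2, map_zero]
    · rw [hmul, hmul, hl, hr, hm, ← mul_assoc, hf.1, map_zero]

theorem trace_one (h : Intertwines α P Q) (hα : IsSymmetry α) : (Q 1).trace = (P 1).trace := by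
  rw [← hα.trace_eq, h, hα.map_one]

theorem trace_adj_one (h : Intertwines α P Q) (hα : IsSymmetry α) :
    (Q (RotaBaxter.adj Q (Q 1))).trace = (P (RotaBaxter.adj P (P 1))).trace := by
  rw [← hα.trace_eq, h, h.adj hα, h, hα.map_one]

end Intertwines

/-! ### Conjugacy, the involution φ and normalization -/

/-- Two operators are conjugate by an automorphism or antiautomorphism. -/
def Conj (P Q : Module.End F (M3 F)) : Prop := ∃ α, IsSymmetry α ∧ Intertwines α P Q

namespace Conj

variable {P Q S : Module.End F (M3 F)}

theorem refl (P : Module.End F (M3 F)) : Conj P P := ⟨_, .refl, fun _ => rfl⟩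

theorem symm : Conj P Q → Conj Q P
  | ⟨_, hα, h⟩ => ⟨_, hα.symm, h.symm⟩

theorem trans : Conj P Q → Conj Q S → Conj P S
  | ⟨_, hα, h⟩, ⟨_, hβ, k⟩ => ⟨_, hβ.trans hα, h.trans k⟩

theorem phi : Conj P Q → Conj (phi 1 P) (phi 1 Q)
  | ⟨_, hα, h⟩ => ⟨_, hα, h.phi⟩

/-- The invariants agree over F; since ℤ embeds in F, so do the integers computed from the tables.
-/
theorem signature_eq [CharZero F] {M N : IOp}
    (h : Conj (toOp M : Module.End F (M3 F)) (toOp N)) : M.signature = N.signature := by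
  have hv : ∀ f : Form, M.vanishes f = N.vanishes f := fun f => by
    rw [Bool.eq_iff_iff, vanishes_iff (F := F), vanishes_iff (F := F)]
    obtain ⟨α, hα, h'⟩ := h
    exact ⟨h'.vanishes hα f, h'.symm.vanishes hα.symm f⟩
  obtain ⟨α, hα, h'⟩ := h
  have h₁ := h'.trace_one hα
  have h₃ := h'.trace_adj_one hα
  rw [trace_toOp_one, trace_toOp_one, Int.cast_inj] at h₁
  rw [trace_toOp_adj_toOp_one, trace_toOp_adj_toOp_one, Int.cast_inj] at h₃
  simp only [IOp.signature, hv, h₁, h₃]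

end Conj

/-- Two operators are conjugate, possibly after applying `φ` to one of them. -/
def PhiConj (P Q : Module.End F (M3 F)) : Prop := Conj P Q ∨ Conj (phi 1 P) Q

namespace PhiConj

variable {P Q S : Module.End F (M3 F)}

theorem symm (h : PhiConj P Q) : PhiConj Q P := by
  refine h.imp Conj.symm fun h => ?_
  simpa only [phi_involutive (1 : F) P] using h.symm.phi

theorem trans (h : PhiConj P Q) (k : PhiConj Q S) : PhiConj P S := by
  rcases h with h | h <;> rcases k with k | k
  · exact Or.inl (h.trans k)
  · exact Or.inr (h.phi.trans k)
  · exact Or.inr (h.trans k)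
  -- Two applications of φ cancel, because φ commutes with conjugation and is an involution.
  · refine Or.inl (Conj.trans ?_ k)
    simpa only [phi_involutive (1 : F) P] using h.phi

end PhiConj

/-- Each generator moves an operator within its `PhiConj` class, and `PhiConj` is an equivalence
relation, so the whole group does. -/
theorem phiConj_of_mem_symmetryGroup {g : Equiv.Perm (Module.End F (M3 F))}
    (hg : g ∈ symmetryGroup F) (P : Module.End F (M3 F)) : PhiConj P (g P) := by
  induction hg using Subgroup.closure_induction generalizing P with
  | mem g hg =>
    rcases hg with (rfl | rfl) | ⟨ψ, rfl⟩
    · exact Or.inr (.refl _)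
    · exact Or.inl ⟨_, .transpose, fun _ => rfl⟩
    · exact Or.inl ⟨_, .of_algEquiv ψ, fun x => ψ.apply_symm_apply _⟩
  | one => exact Or.inl (.refl P)
  | mul g h _ _ hg hh => exact (hh P).trans (hg (h P))
  | inv g _ hg => simpa using (hg (g⁻¹ P)).symm

theorem phiConj_of_orbit_eq {P Q : Module.End F (M3 F)} (h : orbit P = orbit Q) :
    PhiConj P Q := by
  have hQ : Q ∈ orbit P := h ▸ MulAction.mem_orbit_self Q
  obtain ⟨g, rfl⟩ := hQ
  exact phiConj_of_mem_symmetryGroup g.2 P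

theorem phiConj_normalize (M : IOp) :
    PhiConj (toOp M : Module.End F (M3 F)) (toOp M.normalize) := by
  unfold IOp.normalize
  split_ifs
  · exact Or.inl (.refl _)
  · exact Or.inr (toOp_flip (F := F) M ▸ .refl _)

theorem neg_one_le_tr₁_normalize (c : Case) : -1 ≤ (model c).normalize.tr₁ := by
  simpa using List.all_eq_true.mp list_all_tr₁ c c.mem_list

/-- If φ were needed, the integers t, s attached to the two operators would satisfy t + s = -3,
whereas normalization gives t + s ≥ -2. -/
theorem conj_of_phiConj_normalize [CharZero F] {c d : Case}
    (h : PhiConj (toOp (model c).normalize : Module.End F (M3 F)) (toOp (model d).normalize)) :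
    Conj (toOp (model c).normalize : Module.End F (M3 F)) (toOp (model d).normalize) := by
  refine h.resolve_right ?_
  rintro ⟨α, hα, h⟩
  have ht := h.trace_one hα
  -- The constant 3 is the trace of the identity matrix.
  have hphi : (phi 1 (toOp (model c).normalize : Module.End F (M3 F)) 1).trace =
      ((-(model c).normalize.tr₁ - 3 : ℤ) : F) := by
    simp [phi, trace_toOp_one]
  rw [hphi, trace_toOp_one, Int.cast_inj] at ht
  have hc := neg_one_le_tr₁_normalize c
  have hd := neg_one_le_tr₁_normalize d
  omega

end RotaBaxter

open RotaBaxter in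
theorem corollary2 (F : Type*) [Field F] [IsAlgClosed F] [CharZero F] :
    (∀ c : RotaBaxter.Case, RotaBaxter.IsRotaBaxter (1 : F) (RotaBaxter.listed F c)) ∧
    (∀ c d : RotaBaxter.Case, c ≠ d →
      RotaBaxter.orbit (RotaBaxter.listed F c) ≠ RotaBaxter.orbit (RotaBaxter.listed F d)) := by
  refine ⟨fun c => ?_, fun c d hcd horb => hcd ?_⟩
  · rw [listed_eq_toOp]
    exact isRotaBaxter_toOp _ (List.all_eq_true.mp list_all_isRB c c.mem_list)
  · rw [listed_eq_toOp, listed_eq_toOp] at horb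
    -- Equality of orbits is carried over to the normalized representatives, where signatures can be
    -- compared.
    have h := ((phiConj_normalize (model c)).symm.trans (phiConj_of_orbit_eq horb)).trans
      (phiConj_normalize (model d))
    exact List.inj_on_of_nodup_map nodup_signature c.mem_list d.mem_list
      (conj_of_phiConj_normalize h).signature_eq
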